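/- Let $\mathfrak A$ be a unital $C^*$-algebra with unit $\mathbf 1$ and let $A\in\mathfrak A$ be positive and well-supported, i.e. $\sigma(A^*A)\setminus\{0\}$ is closed. Let $\mathcal S(\mathfrak A)$ be the set of states of $\mathfrak A$ (positive linear functionals of norm one), and put $$\mathcal S_A(\mathfrak A)=\Big\{\tfrac{f}{f(A)}: f\in\mathcal S(\mathfrak A),\ f(A)\neq0\Big\},\qquad \|X\|_A=\sup\big\{\sqrt{f(X^*AX)}: f\in\mathcal S_A(\mathfrak A)\big\}\in[0,\infty],$$ and $\mathfrak A^A=\{X\in\mathfrak A:\|X\|_A<\infty\}$. An element $X\in\mathfrak A^A$ is $A$-left (resp. $A$-right) invertible in $\mathfrak A^A$ if there is $Y\in\mathfrak A^A$ with $AYX=A$ (resp. $AXY=A$). For $X\in\mathfrak A^A$ let $\sigma_A^l(X,\mathfrak A)$ (resp. $\sigma_A^r(X,\mathfrak A)$) be the set of $\lambda\in\mathbb C$ such that $\lambda\mathbf 1-X$ is not $A$-left (resp. not $A$-right) invertible in $\mathfrak A^A$, and let $\sigma_A(X,\mathfrak A)=\sigma_A^l(X,\mathfrak A)\cup\sigma_A^r(X,\mathfrak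 A)$. Then for every $X\in\mathfrak A^A$: (i) $\sigma_A^r(X,\mathfrak A)=\big\{f(AX): f\in\mathcal S_A(\mathfrak A),\ f(AXX^*A)=f(AX)f(AX^*A)=|f(AX)|^2f(A^2)\big\}$; (ii) $\sigma_A^l(X,\mathfrak A)=\big\{f(AX): f\in\mathcal S_A(\mathfrak A),\ f(X^*AX)=|f(AX)|^2\big\}$. Moreover, if $\mathfrak B$ is a unital $C^*$-algebra with $A\in\mathfrak B\subseteq\mathfrak A$ (a $C^*$-subalgebra of $\mathfrak A$, embedded by an injective $*$-homomorphism; the unit of $\mathfrak B$ need not be that of $\mathfrak A$), then $\sigma_A(X,\mathfrak A)=\sigma_A(X,\mathfrak B)$ for all $X\in\mathfrak B^A$, where $\mathfrak B^A$ and $\sigma_A(X,\mathfrak B)$ are formed in $\mathfrak B$, with its own states and unit. -/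

import Mathlib

/-!
# `A`-states, the `A`-seminorm and the `A`-spectrum in a unital C*-algebra
-/

namespace ASpectral

noncomputable section

open scoped ComplexOrder

variable {𝔄 : Type*} [CStarAlgebra 𝔄] [PartialOrder 𝔄] [StarOrderedRing 𝔄]

/-- An element `X` of a C*-algebra is well-supported if `σ(X⋆X) \ {0}` is closed. -/
def IsWellSupported {𝔄 : Type*} [CStarAlgebra 𝔄] (X : 𝔄) : Prop :=
  IsClosed (spectrum ℂ (star X * X) \ {0})

variable (𝔄) in
/-- The set `𝒮(𝔄)` of states: the positive (bounded) linear functionals of norm one. -/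
def states : Set (𝔄 →L[ℂ] ℂ) :=
  {f | (∀ X : 𝔄, 0 ≤ X → 0 ≤ f X) ∧ ‖f‖ = 1}

/-- The set `𝒮_A(𝔄) = {f / f(A) : f ∈ 𝒮(𝔄), f(A) ≠ 0}`. -/
def aStates (A : 𝔄) : Set (𝔄 →L[ℂ] ℂ) :=
  {g | ∃ f ∈ states 𝔄, f A ≠ 0 ∧ g = (f A)⁻¹ • f}

/-- The `A`-seminorm `‖X‖_A = sup {√(f(X⋆AX)) : f ∈ 𝒮_A(𝔄)}`, with values in `[0, ∞]`. For
`A ≥ 0` the number `f(X⋆AX)` is real and nonnegative, so that taking its real part is harmless. -/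
def aNorm (A X : 𝔄) : ENNReal :=
  ⨆ f ∈ aStates A, ENNReal.ofReal (Real.sqrt (f (star X * A * X)).re)

/-- The set `𝔄^A` of the elements `X` with `‖X‖_A < ∞`. -/
def aBounded (A : 𝔄) : Set 𝔄 :=
  {X | aNorm A X < ⊤}

/-- `X ∈ 𝔄^A` is `A`-left invertible in `𝔄^A` if `AYX = A` for some `Y ∈ 𝔄^A`. -/
def IsALeftInvertible (A X : 𝔄) : Prop :=
  ∃ Y ∈ aBounded A, A * Y * X = A

/-- `X ∈ 𝔄^A` is `A`-right invertible in `𝔄^A` if `AXY = A` for some `Y ∈ 𝔄^A`. -/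
def IsARightInvertible (A X : 𝔄) : Prop :=
  ∃ Y ∈ aBounded A, A * X * Y = A

/-- The left `A`-spectrum `σ_A^l(X, 𝔄)`. -/
def leftASpectrum (A X : 𝔄) : Set ℂ :=
  {z | ¬ IsALeftInvertible A (z • (1 : 𝔄) - X)}

/-- The right `A`-spectrum `σ_A^r(X, 𝔄)`. -/
def rightASpectrum (A X : 𝔄) : Set ℂ :=
  {z | ¬ IsARightInvertible A (z • (1 : 𝔄) - X)}

/-- The `A`-spectrum `σ_A(X, 𝔄) = σ_A^l(X, 𝔄) ∪ σ_A^r(X, 𝔄)`. -/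
def aSpectrum (A X : 𝔄) : Set ℂ :=
  leftASpectrum A X ∪ rightASpectrum A X

end

end ASpectral

/-!
Since `A` is positive and well-supported, `0` is isolated in `σ(A) ∪ {0}`, so `A` has a group
inverse `D`: a self-adjoint element commuting with `A` with `ADA = A` and `DAD = D`. Then
`P = A * D` is the support projection of `A`, and `A` is invertible in the corner `P𝔄P`.

The idea is that `A`-invertibility is ordinary invertibility in `P𝔄P`. An element `X` has finite
`A`-seminorm exactly if `PX = PXP` (`mem_aBounded_iff`), and such an `X` is `A`-left or `A`-right
invertible exactly if `PXP` is left or right invertible in the corner. To avoid a C*-algebra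
structure on the corner, `PXP` is replaced by `T = PX + (1 - P)`, an element of `𝔄` itself
(`cornerExt`).

If `X` is not `A`-left invertible, then `T⋆T` is not invertible, and some state `h` annihilates it
(`exists_state_map_eq_zero`, by Hahn–Banach). By Cauchy–Schwarz `h` is concentrated on `P`, and
`h (P · P)`, normalized at `A`, is an `A`-state that annihilates `X⋆AX`. Conversely, if
`f (X⋆AX) = 0` and `AYX = A`, Cauchy–Schwarz gives `f A = 0`, which is absurd. On the other side one
uses `TT⋆`, `h (D · D)` and `AXX⋆A`. These are `not_isALeftInvertible_iff` and
`not_isARightInvertible_iff`; applying them to `z - X` and expanding gives the two descriptions of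
the spectra.

For a subalgebra `𝔅`, continuous functional calculus places `D` in `𝔅`. If `PX` has a left inverse
`Q` in the corner of `𝔄`, then `P = (QPX)⋆(QPX) ≤ ‖Q‖² (PX)⋆(PX)`. This inequality passes down to
`𝔅`, because injective *-homomorphisms reflect positivity, and there it makes `T⋆T` invertible. The
same works on the right, so even the one-sided spectra agree. The two units do not matter, as only
`P (z - X)` enters.
-/

namespace ASpectral

open scoped ComplexOrder

/-! ### Positive functionals and states -/

section PositiveFunctionals

/-- For self-adjoint `s` the number `f s` is real: otherwise `|f (s + i t)|` would outgrow
`‖s + i t‖ ≤ √(‖s‖² + t²)` as the real number `t` varies. -/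
lemma im_map_eq_zero_of_isSelfAdjoint {𝔄 : Type*} [CStarAlgebra 𝔄] {f : StrongDual ℂ 𝔄}
    (hf : ‖f‖ ≤ 1) (h1 : f 1 = 1) {s : 𝔄}
    (hs : IsSelfAdjoint s) : (f s).im = 0 := by
  have key (t : ℝ) : ((f s).im + t) ^ 2 ≤ ‖s‖ ^ 2 + t ^ 2 := by
    set u : 𝔄 := s + ((t : ℂ) * Complex.I) • 1 with hu
    have hfu : f u = f s + t * Complex.I := by simp [hu, h1]
    have hsu : star u * u = s * s + ((t : ℂ) ^ 2) • 1 := by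
      rw [hu, star_add, star_smul, hs.star_eq, star_one]
      simp only [add_mul, mul_add, smul_mul_assoc, mul_smul_comm, one_mul, mul_one]
      have h2 : star ((t : ℂ) * Complex.I) = -((t : ℂ) * Complex.I) := by simp
      have h3 : -((t : ℂ) * Complex.I) * ((t : ℂ) * Complex.I) = (t : ℂ) ^ 2 := by
        linear_combination (-(t : ℂ) ^ 2) * Complex.I_sq
      rw [h2, smul_add, smul_smul, mul_comm _ (-_), h3, neg_smul]
      abel
    have hn : ‖u‖ ^ 2 ≤ ‖s‖ ^ 2 + t ^ 2 := by
      have : Nontrivial 𝔄 := nontrivial_of_ne 1 0 fun h ↦ by simp [h] at h1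
      rw [sq, ← CStarRing.norm_star_mul_self, hsu]
      refine (norm_add_le _ _).trans ?_
      gcongr
      · exact (norm_mul_le _ _).trans (sq _).ge
      · simp [norm_smul]
    have h4 : ‖f u‖ ≤ ‖u‖ := (f.le_opNorm u).trans (by nlinarith [norm_nonneg u])
    have h5 : |(f u).im| ≤ ‖u‖ := (Complex.abs_im_le_norm _).trans h4
    have h6 : (f u).im = (f s).im + t := by simp [hfu]
    rw [← h6, ← sq_abs]
    exact (pow_le_pow_left₀ (abs_nonneg _) h5 2).trans hn
  by_contra hne
  -- This `t` makes the cross term `2 t Im f(s)` equal to `‖s‖² + 1`.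
  have := key ((‖s‖ ^ 2 + 1) / (2 * (f s).im))
  have h2 : ((f s).im + (‖s‖ ^ 2 + 1) / (2 * (f s).im)) ^ 2 =
      (f s).im ^ 2 + (‖s‖ ^ 2 + 1) + ((‖s‖ ^ 2 + 1) / (2 * (f s).im)) ^ 2 := by
    field_simp; ring
  nlinarith [sq_nonneg (f s).im]

variable {𝔄 : Type*} [CStarAlgebra 𝔄] [PartialOrder 𝔄] [StarOrderedRing 𝔄]

/-- Cauchy–Schwarz for the semi-inner product `(a, b) ↦ f (a⋆ b)`, in the degenerate case. -/
lemma map_mul_eq_zero_of_map_star_mul_self (f : 𝔄 →ₚ[ℂ] ℂ) {b : 𝔄} (hb : f (star b * b) = 0)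
    (a : 𝔄) : f (a * b) = 0 := by
  have h := norm_inner_le_norm (𝕜 := ℂ) (f.toPreGNS (star a)) (f.toPreGNS b)
  rw [f.preGNS_norm_def (f.toPreGNS b), f.preGNS_inner_def] at h
  simpa [hb] using h

lemma map_star_mul_eq_zero_of_map_star_mul_self (f : 𝔄 →ₚ[ℂ] ℂ) {b : 𝔄}
    (hb : f (star b * b) = 0) (a : 𝔄) : f (star b * a) = 0 := by
  have h := map_mul_eq_zero_of_map_star_mul_self f hb (star a)
  rw [← star_eq_zero, ← map_star f] at h
  simpa using h

/-- The degenerate case of Cauchy–Schwarz for the semi-inner product `(a, b) ↦ f (a⋆ A b)`. -/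
lemma map_mul_mul_eq_zero {A : 𝔄} (hA : 0 ≤ A) (f : 𝔄 →ₚ[ℂ] ℂ) {b : 𝔄}
    (hb : f (star b * A * b) = 0) (a : 𝔄) : f (a * A * b) = 0 := by
  obtain ⟨s, rfl⟩ := CStarAlgebra.nonneg_iff_eq_star_mul_self.mp hA
  have := map_mul_eq_zero_of_map_star_mul_self f (b := s * b)
    (by rw [← hb]; simp [mul_assoc]) (a * star s)
  simpa [mul_assoc] using this

lemma mul_eq_zero_of_star_mul_mul_eq_zero {A : 𝔄} (hA : 0 ≤ A) {b : 𝔄}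
    (hb : star b * A * b = 0) : A * b = 0 := by
  obtain ⟨s, rfl⟩ := CStarAlgebra.nonneg_iff_eq_star_mul_self.mp hA
  have : s * b = 0 := CStarRing.star_mul_self_eq_zero_iff _ |>.mp (by rw [← hb]; simp [mul_assoc])
  rw [mul_assoc, this, mul_zero]

/-- A functional of norm at most one that maps `1` to `1` is positive: for `x ≥ 0`, the bound
`‖‖x‖ - x‖ ≤ ‖x‖` puts `f x` into the disc of radius `‖x‖` about `‖x‖`. -/
lemma nonneg_map_of_norm_le_one {f : StrongDual ℂ 𝔄} (hf : ‖f‖ ≤ 1) (h1 : f 1 = 1) {x : 𝔄}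
    (hx : 0 ≤ x) : 0 ≤ f x := by
  refine Complex.nonneg_iff.mpr
    ⟨?_, (im_map_eq_zero_of_isSelfAdjoint hf h1 (IsSelfAdjoint.of_nonneg hx)).symm⟩
  have hle : x ≤ algebraMap ℝ 𝔄 ‖x‖ := IsSelfAdjoint.le_algebraMap_norm_self (.of_nonneg hx)
  have hn : ‖algebraMap ℝ 𝔄 ‖x‖ - x‖ ≤ ‖x‖ :=
    (CStarAlgebra.norm_le_iff_le_algebraMap _ (norm_nonneg x) (sub_nonneg.mpr hle)).mpr
      (sub_le_self _ hx)
  have h2 : f (algebraMap ℝ 𝔄 ‖x‖ - x) = ‖x‖ - f x := by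
    rw [map_sub, Algebra.algebraMap_eq_smul_one, ← Complex.coe_smul, map_smul, h1]; simp
  have h3 : ‖(‖x‖ : ℂ) - f x‖ ≤ ‖x‖ := by
    rw [← h2]
    exact (f.le_opNorm _).trans (by nlinarith [norm_nonneg (algebraMap ℝ 𝔄 ‖x‖ - x)])
  have h4 := (Complex.re_le_norm _).trans h3
  simp at h4
  linarith

/-- A noninvertible positive element is annihilated by a state. With `c > ‖H‖`, the functional is a
Hahn–Banach functional attaining the norm of `2c - H`, which is at least `2c` because `0 ∈ σ(H)`;
since `‖c - H‖ ≤ c`, it has to map `1` to `1` and `H` to `0`. -/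
lemma exists_state_map_eq_zero {H : 𝔄} (hH : 0 ≤ H) (hu : ¬ IsUnit H) :
    ∃ h : 𝔄 →ₚ[ℂ] ℂ, h 1 = 1 ∧ h H = 0 := by
  have : Nontrivial 𝔄 := by
    by_contra hn
    rw [not_nontrivial_iff_subsingleton] at hn
    exact hu (isUnit_of_subsingleton H)
  set c : ℝ := ‖H‖ + 1 with hc
  have hc0 : 0 < c := by positivity
  obtain ⟨f, hf1, hf⟩ := exists_dual_vector'' ℂ (algebraMap ℝ 𝔄 (2 * c) - H)
  have hM : 2 * c ≤ ‖algebraMap ℝ 𝔄 (2 * c) - H‖ := by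
    have h1 : 2 * c ∈ spectrum ℝ (algebraMap ℝ 𝔄 (2 * c) - H) := by
      rw [spectrum.mem_iff]
      simpa using hu
    exact (le_abs_self _).trans (spectrum.norm_le_norm_of_mem h1)
  have hN : ‖algebraMap ℝ 𝔄 c - H‖ ≤ c := by
    have hle : H ≤ algebraMap ℝ 𝔄 c :=
      (IsSelfAdjoint.le_algebraMap_norm_self (.of_nonneg hH)).trans
        (algebraMap_mono 𝔄 (by linarith))
    exact (CStarAlgebra.norm_le_iff_le_algebraMap _ hc0.le (sub_nonneg.mpr hle)).mpr
      (sub_le_self _ hH)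
  have hg : f (algebraMap ℝ 𝔄 (2 * c) - H) = c * f 1 + f (algebraMap ℝ 𝔄 c - H) := by
    simp only [map_sub, Algebra.algebraMap_eq_smul_one, ← Complex.coe_smul, map_smul]
    push_cast
    simp only [smul_eq_mul]
    ring
  have hfn : ‖f (algebraMap ℝ 𝔄 c - H)‖ ≤ c :=
    (f.le_opNorm _).trans (by nlinarith [norm_nonneg (algebraMap ℝ 𝔄 c - H)])
  have hf1n : ‖f 1‖ ≤ 1 := (f.le_opNorm _).trans (by simpa using hf1)
  have hre : 1 ≤ (f 1).re := by
    have h1 := congrArg Complex.re (hf.symm.trans hg)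
    have h2 := (Complex.re_le_norm _).trans hfn
    rw [Complex.add_re, Complex.re_ofReal_mul] at h1
    change ‖_‖ = _ at h1
    by_contra! hlt
    nlinarith
  have h1 : f 1 = 1 := by
    have h2 : (f 1).re ^ 2 + (f 1).im ^ 2 ≤ 1 := by
      have := Complex.sq_norm (f 1)
      rw [Complex.normSq_apply] at this
      nlinarith [norm_nonneg (f 1)]
    have h3 : (f 1).im = 0 := by nlinarith [sq_nonneg (f 1).im]
    have h4 : (f 1).re = 1 := by nlinarith
    exact Complex.ext (by simpa using h4) (by simpa using h3)
  refine ⟨PositiveLinearMap.mk₀ (f : 𝔄 →ₗ[ℂ] ℂ) fun x hx ↦ nonneg_map_of_norm_le_one hf1 h1 hx,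
    h1, ?_⟩
  refine le_antisymm ?_ (nonneg_map_of_norm_le_one hf1 h1 hH)
  change f H ≤ 0
  have h2 : f (algebraMap ℝ 𝔄 (2 * c) - H) = ((2 * c : ℝ) : ℂ) - f H := by
    rw [map_sub, Algebra.algebraMap_eq_smul_one, ← Complex.coe_smul, map_smul, h1]; simp
  have h3 : f H = ((2 * c - ‖algebraMap ℝ 𝔄 (2 * c) - H‖ : ℝ) : ℂ) := by
    rw [Complex.ofReal_sub, eq_sub_iff_add_eq']
    exact (eq_sub_iff_add_eq.mp (hf.symm.trans h2)).symm ▸ rfl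
  rw [h3, ← Complex.ofReal_zero, Complex.real_le_real]
  linarith

/-- Positive functionals separate positive elements from `0`. -/
lemma exists_positive_map_eq_norm [Nontrivial 𝔄] {E : 𝔄} (hE : 0 ≤ E) :
    ∃ h : 𝔄 →ₚ[ℂ] ℂ, h E = ‖E‖ := by
  have hle : E ≤ algebraMap ℝ 𝔄 ‖E‖ := IsSelfAdjoint.le_algebraMap_norm_self (.of_nonneg hE)
  have hmem : ‖E‖ ∈ spectrum ℝ E := CStarAlgebra.norm_mem_spectrum_of_nonneg hE
  obtain ⟨h, h1, h2⟩ := exists_state_map_eq_zero (sub_nonneg.mpr hle) hmem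
  refine ⟨h, ?_⟩
  rw [map_sub, Algebra.algebraMap_eq_smul_one, ← Complex.coe_smul, map_smul, h1, sub_eq_zero] at h2
  simpa using h2.symm

/-- The positive functional `x ↦ h (c⋆ x c)`. -/
noncomputable def conjFunctional (h : 𝔄 →ₚ[ℂ] ℂ) (c : 𝔄) : 𝔄 →ₚ[ℂ] ℂ :=
  PositiveLinearMap.mk₀
    ((h.toLinearMap ∘ₗ LinearMap.mulLeft ℂ (star c)) ∘ₗ LinearMap.mulRight ℂ c)
    fun x hx ↦ by
      simpa [mul_assoc] using h.map_nonneg (star_left_conjugate_nonneg hx c)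

@[simp]
lemma conjFunctional_apply (h : 𝔄 →ₚ[ℂ] ℂ) (c x : 𝔄) :
    conjFunctional h c x = h (star c * x * c) := by
  rw [mul_assoc]
  rfl

end PositiveFunctionals

/-! ### `A`-states as normalized positive functionals -/

section AStates

variable {𝔄 : Type*} [CStarAlgebra 𝔄] [PartialOrder 𝔄]

/-- The `A`-states are the positive functionals that take the value `1` at `A`. -/
lemma mem_aStates_iff {A : 𝔄} (hA : 0 ≤ A) {g : 𝔄 →L[ℂ] ℂ} :
    g ∈ aStates A ↔ (∀ X : 𝔄, 0 ≤ X → 0 ≤ g X) ∧ g A = 1 := by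
  constructor
  · rintro ⟨f, ⟨hf, -⟩, hfA, rfl⟩
    refine ⟨fun X hX ↦ ?_, by simp [hfA]⟩
    simpa using mul_nonneg (inv_nonneg.mpr (hf A hA)) (hf X hX)
  · rintro ⟨hg, hgA⟩
    have hn : ‖g‖ ≠ 0 := by
      rw [norm_ne_zero_iff]
      rintro rfl
      simp at hgA
    have hn' : (‖g‖ : ℂ) ≠ 0 := by exact_mod_cast hn
    refine ⟨(‖g‖ : ℂ)⁻¹ • g, ⟨fun X hX ↦ ?_, ?_⟩, ?_, ?_⟩
    · have : (0 : ℂ) ≤ ‖g‖ := by exact_mod_cast norm_nonneg g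
      simpa using mul_nonneg (inv_nonneg.mpr this) (hg X hX)
    · rw [norm_smul]
      simp [hn]
    · simp [hgA, hn]
    · simp [hgA, smul_smul, hn']

variable [StarOrderedRing 𝔄]

lemma exists_positive_of_mem_aStates {A : 𝔄} (hA : 0 ≤ A) {g : 𝔄 →L[ℂ] ℂ} (hg : g ∈ aStates A) :
    ∃ f : 𝔄 →ₚ[ℂ] ℂ, (∀ x, g x = f x) ∧ f A = 1 :=
  have h := (mem_aStates_iff hA).mp hg
  ⟨PositiveLinearMap.mk₀ (g : 𝔄 →ₗ[ℂ] ℂ) h.1, fun _ ↦ rfl, h.2⟩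

lemma exists_aState_of_positive {A : 𝔄} (hA : 0 ≤ A) (h : 𝔄 →ₚ[ℂ] ℂ) (hne : h A ≠ 0) :
    ∃ g ∈ aStates A, ∀ x, g x = (h A)⁻¹ * h x := by
  let g : 𝔄 →L[ℂ] ℂ := ⟨(h A)⁻¹ • h.toLinearMap, (map_continuous h).const_smul (h A)⁻¹⟩
  refine ⟨g, (mem_aStates_iff hA).mpr ⟨fun X hX ↦ ?_, inv_mul_cancel₀ hne⟩, fun x ↦ rfl⟩
  exact mul_nonneg (inv_nonneg.mpr (h.map_nonneg hA)) (h.map_nonneg hX)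

end AStates

/-! ### The group inverse of a well-supported element -/

section GroupInverse

/-- `D` is the self-adjoint group inverse of `A`: it commutes with `A`, and `ADA = A`, `DAD = D`.
If `A` is self-adjoint, then `A * D` is the support projection of `A`. -/
structure IsGroupInverse {R : Type*} [Mul R] [Star R] (A D : R) : Prop where
  comm : D * A = A * D
  mul_mul_self : A * D * A = A
  self_mul_mul : D * A * D = D
  isSelfAdjoint : IsSelfAdjoint D

namespace IsGroupInverse

variable {R : Type*} [Semigroup R] [StarMul R] {A D : R}

lemma mul_proj (h : IsGroupInverse A D) : A * (A * D) = A := by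
  rw [← h.comm, ← mul_assoc, h.mul_mul_self]

lemma proj_mul_proj (h : IsGroupInverse A D) : A * D * (A * D) = A * D := by
  rw [← mul_assoc, h.mul_mul_self]

lemma star_proj (h : IsGroupInverse A D) (hA : IsSelfAdjoint A) : star (A * D) = A * D := by
  rw [star_mul, hA.star_eq, h.isSelfAdjoint.star_eq, h.comm]

lemma isStarProjection (h : IsGroupInverse A D) (hA : IsSelfAdjoint A) :
    IsStarProjection (A * D) :=
  ⟨h.proj_mul_proj, h.star_proj hA⟩

lemma of_map {S F : Type*} [Semigroup S] [StarMul S] [FunLike F S R] [MulHomClass F S R]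
    [StarHomClass F S R] (φ : F) (hφ : Function.Injective φ) {B E : S}
    (h : IsGroupInverse (φ B) (φ E)) : IsGroupInverse B E where
  comm := hφ (by simpa using h.comm)
  mul_mul_self := hφ (by simpa using h.mul_mul_self)
  self_mul_mul := hφ (by simpa using h.self_mul_mul)
  isSelfAdjoint := hφ (by rw [map_star, h.isSelfAdjoint.star_eq])

end IsGroupInverse

variable {𝔄 : Type*} [CStarAlgebra 𝔄]

/-- Well-supportedness says that `0` is isolated in `σ(A) ∪ {0}`, so that `x ↦ x⁻¹` (with
`0⁻¹ = 0`) is continuous there. -/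
lemma continuousOn_inv_quasispectrum {A : 𝔄} (hA : IsSelfAdjoint A) (hAws : IsWellSupported A) :
    ContinuousOn (fun x : ℝ ↦ x⁻¹) (quasispectrum ℝ A) := by
  intro x hx
  by_cases hx0 : x = 0
  · subst hx0
    have hcont : Continuous fun x : ℝ ↦ (((x ^ 2 : ℝ)) : ℂ) := by fun_prop
    have hev := hcont.continuousAt.preimage_mem_nhds (x := 0) (hAws.isOpen_compl.mem_nhds (by simp))
    refine (continuousWithinAt_const (b := (0 : ℝ))).congr_of_eventuallyEq ?_ inv_zero
    filter_upwards [mem_nhdsWithin_of_mem_nhds hev, self_mem_nhdsWithin] with y hy hyq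
    rw [inv_eq_zero]
    by_contra hy0
    -- A nonzero `y ∈ σ(A)` puts `y² ≠ 0` into `σ(A⋆A)`, which `y²` avoids for `y` close to `0`.
    refine hy ⟨?_, by simpa using hy0⟩
    rw [quasispectrum_eq_spectrum_union_zero] at hyq
    have hys : y ∈ spectrum ℝ A := hyq.resolve_right (by simpa using hy0)
    have h2 : y ^ 2 ∈ spectrum ℝ (A ^ 2) := spectrum.pow_mem_pow A 2 hys
    rw [hA.star_eq, ← sq]
    exact spectrum.algebraMap_mem ℂ h2
  · exact (continuousAt_inv₀ hx0).continuousWithinAt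

lemma isGroupInverse_cfcₙ_inv {A : 𝔄} (hA : IsSelfAdjoint A) (hAws : IsWellSupported A) :
    IsGroupInverse A (cfcₙ (fun x : ℝ ↦ x⁻¹) A) := by
  have hc := continuousOn_inv_quasispectrum hA hAws
  have h1 : A * cfcₙ (fun x : ℝ ↦ x⁻¹) A = cfcₙ (fun x : ℝ ↦ x * x⁻¹) A := by
    conv_lhs => enter [1]; rw [← cfcₙ_id' ℝ A]
    rw [← cfcₙ_mul (fun x : ℝ ↦ x) (fun x : ℝ ↦ x⁻¹) A]
  have h2 : cfcₙ (fun x : ℝ ↦ x⁻¹) A * A = cfcₙ (fun x : ℝ ↦ x * x⁻¹) A := by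
    conv_lhs => enter [2]; rw [← cfcₙ_id' ℝ A]
    rw [← cfcₙ_mul (fun x : ℝ ↦ x⁻¹) (fun x : ℝ ↦ x) A]
    simp_rw [mul_comm]
  have hc2 : ContinuousOn (fun x : ℝ ↦ x * x⁻¹) (quasispectrum ℝ A) := continuousOn_id.mul hc
  refine ⟨h2.trans h1.symm, ?_, ?_, cfcₙ_predicate _ A⟩
  · rw [h1]
    conv_lhs => enter [2]; rw [← cfcₙ_id' ℝ A]
    rw [← cfcₙ_mul (fun x : ℝ ↦ x * x⁻¹) (fun x : ℝ ↦ x) A]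
    simp [cfcₙ_id' ℝ A]
  · rw [h2, ← cfcₙ_mul (fun x : ℝ ↦ x * x⁻¹) (fun x : ℝ ↦ x⁻¹) A]
    congr 1
    ext x
    by_cases hx : x = 0 <;> simp [hx]

/-- The group inverse of a well-supported self-adjoint element lies in every C*-subalgebra that
contains the element, whatever the unit of the subalgebra. -/
lemma exists_isGroupInverse_map {𝔅 : Type*} [CStarAlgebra 𝔅] (ι : 𝔅 →⋆ₙₐ[ℂ] 𝔄)
    (hι : Function.Injective ι) {B : 𝔅} (hB : IsSelfAdjoint (ι B)) (hws : IsWellSupported (ι B)) :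
    ∃ E : 𝔅, IsGroupInverse B E ∧ IsGroupInverse (ι B) (ι E) := by
  have h := isGroupInverse_cfcₙ_inv hB hws
  have : IsClosed (NonUnitalStarAlgHom.range ι : Set 𝔄) := by
    rw [NonUnitalStarAlgHom.coe_range]
    exact (NonUnitalStarAlgHom.isometry ι hι).isClosedEmbedding.isClosed_range
  have hmem : ι B ∈ NonUnitalStarAlgHom.range ι := ⟨B, rfl⟩
  obtain ⟨E, hE⟩ := cfcₙ_mem (𝕜' := ℂ) (fun x : ℝ ↦ x⁻¹) hmem
  rw [← hE] at h
  exact ⟨E, .of_map ι hι h, h⟩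

/-- An injective *-homomorphism reflects positivity of self-adjoint elements: the negative part `y`
satisfies `-y³ = y x y`, so that `ι (y³)` is both positive and negative. -/
lemma nonneg_of_map_nonneg {𝔅 : Type*} [CStarAlgebra 𝔅] [PartialOrder 𝔅] [StarOrderedRing 𝔅]
    [PartialOrder 𝔄] [StarOrderedRing 𝔄] (ι : 𝔅 →⋆ₙₐ[ℂ] 𝔄)
    (hι : Function.Injective ι) {x : 𝔅} (hx : IsSelfAdjoint x) (h : 0 ≤ ι x) : 0 ≤ x := by
  rw [← CFC.negPart_eq_zero_iff x hx]
  have hy : 0 ≤ x⁻ := CFC.negPart_nonneg x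
  have hys : star (x⁻) = x⁻ := (IsSelfAdjoint.of_nonneg hy).star_eq
  have hιy : 0 ≤ ι (x⁻) := map_nonneg ι hy
  have h1 : x⁻ * x * x⁻ = -(x⁻ * x⁻ * x⁻) := by
    conv_lhs => enter [1, 2]; rw [← CFC.posPart_sub_negPart x hx]
    rw [mul_sub, CFC.negPart_mul_posPart, zero_sub, neg_mul]
  have h2 : 0 ≤ ι (x⁻ * x * x⁻) := by
    have := star_left_conjugate_nonneg h (ι x⁻)
    simpa only [← map_star, ← map_mul, hys] using this
  have h3 : 0 ≤ ι (x⁻ * x⁻ * x⁻) := by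
    have := star_left_conjugate_nonneg hιy (ι x⁻)
    simpa only [← map_star, ← map_mul, hys] using this
  rw [h1, map_neg, neg_nonneg] at h2
  have h4 : x⁻ * x⁻ * x⁻ = 0 := (map_eq_zero_iff ι hι).mp (le_antisymm h2 h3)
  have h5 : x⁻ * x⁻ = 0 := by
    rw [← CStarRing.star_mul_self_eq_zero_iff, star_mul, hys, ← mul_assoc, h4, zero_mul]
  rwa [← CStarRing.star_mul_self_eq_zero_iff, hys]

end GroupInverse

/-! ### Extending an element of the corner by the identity -/

section CornerExt

variable {𝔄 : Type*} [CStarAlgebra 𝔄] {A D : 𝔄}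

/-- For `X ∈ 𝔄^A`, the element `PX + (1 - P)`, where `P = A * D`, acts as `PXP` on the corner
`P𝔄P` and as the identity on the complementary corner. -/
def cornerExt (A D X : 𝔄) : 𝔄 := A * D * X + (1 - A * D)

lemma proj_mul_cornerExt (hD : IsGroupInverse A D) (X : 𝔄) :
    A * D * cornerExt A D X = A * D * X := by
  rw [cornerExt, mul_add, ← mul_assoc, mul_sub, hD.proj_mul_proj, mul_one, sub_self, add_zero]

lemma one_sub_proj_mul_cornerExt (hD : IsGroupInverse A D) (X : 𝔄) :
    (1 - A * D) * cornerExt A D X = 1 - A * D := by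
  rw [sub_mul, proj_mul_cornerExt hD, one_mul, cornerExt, add_sub_cancel_left]

lemma mul_cornerExt (hD : IsGroupInverse A D) (X : 𝔄) : A * cornerExt A D X = A * X := by
  rw [cornerExt, mul_add, ← mul_assoc A, hD.mul_proj, mul_sub, hD.mul_proj, mul_one, sub_self,
    add_zero]

lemma star_cornerExt_mul_cornerExt (hA : IsSelfAdjoint A) (hD : IsGroupInverse A D) (X : 𝔄) :
    star (cornerExt A D X) * cornerExt A D X =
      star (A * D * X) * (A * D * X) + (1 - A * D) := by
  have h1 : (1 - A * D) * (A * D * X) = 0 := by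
    rw [← mul_assoc, sub_mul, hD.proj_mul_proj, one_mul, sub_self, zero_mul]
  have h2 : star (A * D * X) * (1 - A * D) = 0 := by
    have := congrArg star h1
    rwa [star_mul, star_sub, star_one, hD.star_proj hA, star_zero] at this
  have h3 : star (cornerExt A D X) = star (A * D * X) + (1 - A * D) := by
    rw [cornerExt, star_add, star_sub, star_one, hD.star_proj hA]
  rw [h3, add_mul, one_sub_proj_mul_cornerExt hD, cornerExt, mul_add, h2, add_zero]

end CornerExt

/-! ### Elements of finite `A`-seminorm and the corner of the support projection -/

section Corner

variable {𝔄 : Type*} [CStarAlgebra 𝔄] [PartialOrder 𝔄] [StarOrderedRing 𝔄] {A D : 𝔄}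

/-- A positive functional that annihilates `A` annihilates `X⋆AX` when `X ∈ 𝔄^A`: adding large
multiples of it to an `A`-state produces `A`-states. -/
lemma map_star_mul_mul_eq_zero_of_mem_aBounded (hA : 0 ≤ A) {X : 𝔄} (hX : X ∈ aBounded A)
    {g f : 𝔄 →ₚ[ℂ] ℂ} (hg : g A = 1) (hf : f A = 0) : f (star X * A * X) = 0 := by
  have hE : 0 ≤ star X * A * X := star_left_conjugate_nonneg hA X
  set c := (aNorm A X).toReal
  have hgE := Complex.nonneg_iff.mp (g.map_nonneg hE)
  have hfE := Complex.nonneg_iff.mp (f.map_nonneg hE)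
  have key (n : ℕ) : n * (f (star X * A * X)).re ≤ c ^ 2 := by
    obtain ⟨k, hk, hkx⟩ := exists_aState_of_positive hA (g + n • f) (by simp [hg, hf])
    have h1 : ENNReal.ofReal (Real.sqrt (k (star X * A * X)).re) ≤ aNorm A X :=
      le_iSup₂ (f := fun f (_ : f ∈ aStates A) ↦
        ENNReal.ofReal (Real.sqrt (f (star X * A * X)).re)) k hk
    rw [ENNReal.ofReal_le_iff_le_toReal hX.ne, Real.sqrt_le_left ENNReal.toReal_nonneg, hkx] at h1
    simp [hg, hf] at h1
    linarith [hgE.1]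
  have hre : (f (star X * A * X)).re = 0 := by
    by_contra hne
    have hpos := lt_of_le_of_ne hfE.1 (Ne.symm hne)
    obtain ⟨n, hn⟩ := exists_nat_gt (c ^ 2 / (f (star X * A * X)).re)
    rw [div_lt_iff₀ hpos] at hn
    exact (key n).not_gt hn
  exact Complex.ext hre hfE.2.symm

/-- Membership in `𝔄^A` means that `X` maps the kernel of the support projection `P = A * D` into
itself, that is `PX = PXP`. -/
lemma mem_aBounded_iff (hA : 0 ≤ A) (hD : IsGroupInverse A D) {X : 𝔄} :
    X ∈ aBounded A ↔ A * X * (A * D) = A * X := by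
  have hAs : IsSelfAdjoint A := .of_nonneg hA
  have hP := hD.star_proj hAs
  constructor
  · intro hX
    -- For `A = 0` there are no `A`-states, and both sides hold trivially.
    by_cases hA0 : A = 0
    · simp [hA0]
    have : Nontrivial 𝔄 := nontrivial_of_ne _ _ hA0
    obtain ⟨g, hg⟩ := exists_positive_map_eq_norm hA
    have hn : (‖A‖ : ℂ) ≠ 0 := by simpa using hA0
    obtain ⟨g₁, hg₁, -⟩ := exists_aState_of_positive hA g (hg ▸ hn)
    obtain ⟨g₂, -, hg₂⟩ := exists_positive_of_mem_aStates hA hg₁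
    set Q := 1 - A * D with hQ
    have hQs : star Q = Q := by simp [hQ, hP]
    set E := star Q * (star X * A * X) * Q with hE
    have hE0 : 0 ≤ E := star_left_conjugate_nonneg (star_left_conjugate_nonneg hA X) Q
    obtain ⟨h, hh⟩ := exists_positive_map_eq_norm hE0
    -- The functional `h (Q · Q)` annihilates `A`, hence `X⋆AX`, so that `E = 0`.
    have hAQ : A * Q = 0 := by rw [hQ, mul_sub, mul_one, hD.mul_proj, sub_self]
    have h0 := map_star_mul_mul_eq_zero_of_mem_aBounded hA hX hg₂
      (f := conjFunctional h Q) (by simp [mul_assoc, hAQ])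
    rw [conjFunctional_apply, ← hE, hh] at h0
    have hE1 : E = 0 := by simpa using h0
    have h2 : A * (X * Q) = 0 := mul_eq_zero_of_star_mul_mul_eq_zero hA (by
      rw [← hE1, hE]; simp only [star_mul, mul_assoc])
    rw [hQ, mul_sub, mul_one, mul_sub, sub_eq_zero] at h2
    rw [mul_assoc]
    exact h2.symm
  · intro hX
    obtain ⟨s, hs, rfl⟩ := CStarAlgebra.nonneg_iff_exists_isSelfAdjoint_and_eq_mul_self.mp hA
    set A := s * s with hAdef
    -- As `AX = AXDA`, the element `X⋆AX` is `s M s` with `M` as follows and `s² = A`.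
    set M := s * D * (star X * A * X) * D * s with hM
    have hMs : IsSelfAdjoint M := by
      simp only [IsSelfAdjoint, hM, star_mul, star_star, hs.star_eq, hD.isSelfAdjoint.star_eq,
        hAs.star_eq, mul_assoc]
    have h1 : star X * A * X ≤ ‖M‖ • A := by
      have h2 : star s * M * s = star X * A * X := by
        have hX' : A * D * (star X * A) = star X * A := by
          have := congrArg star hX
          simpa only [star_mul, hAs.star_eq, hD.isSelfAdjoint.star_eq, hD.comm] using this
        calc star s * M * s = A * D * (star X * A) * X * (D * A) := by
              rw [hs.star_eq, hM]; simp only [hAdef, mul_assoc]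
          _ = star X * (A * X * (A * D)) := by rw [hX', hD.comm]; simp only [mul_assoc]
          _ = star X * A * X := by rw [hX]; exact (mul_assoc _ _ _).symm
      have := CStarAlgebra.star_left_conjugate_le_norm_smul (a := s) hMs
      rwa [h2, hs.star_eq] at this
    refine lt_of_le_of_lt ?_ (ENNReal.ofReal_lt_top (r := Real.sqrt ‖M‖))
    refine iSup₂_le fun f hf ↦ ENNReal.ofReal_le_ofReal (Real.sqrt_le_sqrt ?_)
    have hf' := (mem_aStates_iff hA).mp hf
    have h3 := hf'.1 _ (sub_nonneg.mpr h1)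
    rw [map_sub, ← Complex.coe_smul, map_smul, hf'.2] at h3
    simpa using (Complex.nonneg_iff.mp h3).1

lemma proj_mul_mul_proj (hA : 0 ≤ A) (hD : IsGroupInverse A D) {X : 𝔄} (hX : X ∈ aBounded A) :
    A * D * X * (A * D) = A * D * X := by
  have := congrArg (D * ·) ((mem_aBounded_iff hA hD).mp hX)
  simpa only [← mul_assoc, hD.comm] using this

lemma smul_one_sub_mem_aBounded (hA : 0 ≤ A) (hD : IsGroupInverse A D) {X : 𝔄}
    (hX : X ∈ aBounded A) (z : ℂ) : z • (1 : 𝔄) - X ∈ aBounded A := by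
  rw [mem_aBounded_iff hA hD] at hX ⊢
  rw [mul_sub, sub_mul, hX]
  simp [hD.mul_proj]

lemma proj_mul_mul_proj_mem_aBounded (hA : 0 ≤ A) (hD : IsGroupInverse A D) (X : 𝔄) :
    A * D * X * (A * D) ∈ aBounded A := by
  rw [mem_aBounded_iff hA hD, mul_assoc, mul_assoc (A * D * X), hD.proj_mul_proj]

lemma proj_mul_mem_aBounded (hA : 0 ≤ A) (hD : IsGroupInverse A D) {X : 𝔄}
    (hX : X ∈ aBounded A) : A * D * X ∈ aBounded A :=
  proj_mul_mul_proj hA hD hX ▸ proj_mul_mul_proj_mem_aBounded hA hD X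

lemma isALeftInvertible_proj_mul_iff (hA : 0 ≤ A) (hD : IsGroupInverse A D) {X : 𝔄} :
    IsALeftInvertible A (A * D * X) ↔ IsALeftInvertible A X := by
  refine exists_congr fun Y ↦ and_congr_right fun hY ↦ ?_
  rw [← mul_assoc, (mem_aBounded_iff hA hD).mp hY]

lemma isARightInvertible_proj_mul_iff {𝔄 : Type*} [CStarAlgebra 𝔄] [PartialOrder 𝔄] {A D : 𝔄}
    (hD : IsGroupInverse A D) {X : 𝔄} :
    IsARightInvertible A (A * D * X) ↔ IsARightInvertible A X := by
  refine exists_congr fun Y ↦ and_congr_right fun _ ↦ ?_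
  rw [← mul_assoc A, hD.mul_proj]

lemma cornerExt_mul_proj (hA : 0 ≤ A) (hD : IsGroupInverse A D) {X : 𝔄} (hX : X ∈ aBounded A) :
    cornerExt A D X * (A * D) = A * D * X := by
  rw [cornerExt, add_mul, sub_mul, hD.proj_mul_proj, proj_mul_mul_proj hA hD hX]
  simp

lemma cornerExt_mul_one_sub_proj (hA : 0 ≤ A) (hD : IsGroupInverse A D) {X : 𝔄}
    (hX : X ∈ aBounded A) : cornerExt A D X * (1 - A * D) = 1 - A * D := by
  rw [mul_sub, cornerExt_mul_proj hA hD hX, mul_one, cornerExt, add_sub_cancel_left]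

lemma cornerExt_mul_star_cornerExt (hA : 0 ≤ A) (hD : IsGroupInverse A D) {X : 𝔄}
    (hX : X ∈ aBounded A) :
    cornerExt A D X * star (cornerExt A D X) =
      A * D * X * star (A * D * X) + (1 - A * D) := by
  have hP := hD.star_proj (.of_nonneg hA)
  have h1 : A * D * X * (1 - A * D) = 0 := by
    rw [mul_sub, mul_one, proj_mul_mul_proj hA hD hX, sub_self]
  have h2 : (1 - A * D) * star (A * D * X) = 0 := by
    have := congrArg star h1
    rwa [star_mul, star_sub, star_one, hP, star_zero] at this
  have h3 : star (cornerExt A D X) = star (A * D * X) + (1 - A * D) := by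
    rw [cornerExt, star_add, star_sub, star_one, hP]
  rw [h3, mul_add, cornerExt_mul_one_sub_proj hA hD hX, cornerExt, add_mul, h2, add_zero]

/-- If `T⋆T` is invertible for `T = PX + (1 - P)`, then `T` has a left inverse `S`, and `PSP` is an
`A`-left inverse of `X`. -/
lemma isALeftInvertible_of_isUnit (hA : 0 ≤ A) (hD : IsGroupInverse A D) {X : 𝔄}
    (hX : X ∈ aBounded A) (h : IsUnit (star (cornerExt A D X) * cornerExt A D X)) :
    IsALeftInvertible A X := by
  obtain ⟨R, hR⟩ := h.exists_left_inv
  set T := cornerExt A D X with hT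
  set S := R * star T
  have hST : S * T = 1 := by rw [← hR, mul_assoc]
  refine ⟨A * D * S * (A * D), proj_mul_mul_proj_mem_aBounded hA hD S, ?_⟩
  calc A * (A * D * S * (A * D)) * X = A * (A * D) * S * (A * D * X) := by simp only [mul_assoc]
    _ = A * S * (T * (A * D)) := by rw [hD.mul_proj, cornerExt_mul_proj hA hD hX]
    _ = A * (S * T) * (A * D) := by simp only [mul_assoc]
    _ = A := by rw [hST, mul_one, hD.mul_proj]

/-- If `TT⋆` is invertible for `T = PX + (1 - P)`, then `T` has a right inverse `S`, and `PSP` is an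
`A`-right inverse of `X`. -/
lemma isARightInvertible_of_isUnit (hA : 0 ≤ A) (hD : IsGroupInverse A D) {X : 𝔄}
    (hX : X ∈ aBounded A) (h : IsUnit (cornerExt A D X * star (cornerExt A D X))) :
    IsARightInvertible A X := by
  obtain ⟨R, hR⟩ := h.exists_right_inv
  set T := cornerExt A D X with hT
  set S := star T * R
  have hST : T * S = 1 := by rw [← hR, mul_assoc]
  refine ⟨A * D * S * (A * D), proj_mul_mul_proj_mem_aBounded hA hD S, ?_⟩
  calc A * X * (A * D * S * (A * D)) = A * X * (A * D) * S * (A * D) := by simp only [mul_assoc]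
    _ = A * T * S * (A * D) := by rw [(mem_aBounded_iff hA hD).mp hX, mul_cornerExt hD]
    _ = A * (T * S) * (A * D) := by simp only [mul_assoc]
    _ = A := by rw [hST, mul_one, hD.mul_proj]

/-- A positive functional that takes the value `1` at the support projection of `A` is nonzero at
`A` and at the group inverse of `A`, hence can be normalized there. -/
lemma map_ne_zero_of_map_proj_eq_one (hA : 0 ≤ A) (hD : IsGroupInverse A D) {h : 𝔄 →ₚ[ℂ] ℂ}
    (hP : h (A * D) = 1) : h A ≠ 0 ∧ h D ≠ 0 := by
  constructor <;> intro h0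
  · have := map_mul_mul_eq_zero hA h (b := 1) (by simpa using h0) D
    rw [mul_one, hD.comm, hP] at this
    exact one_ne_zero this
  · have := map_mul_mul_eq_zero hA h (b := D)
      (by rw [hD.isSelfAdjoint.star_eq, hD.self_mul_mul, h0]) 1
    rw [one_mul, hP] at this
    exact one_ne_zero this

end Corner

/-! ### The left and right `A`-spectra through `A`-states -/

section Spectra

variable {𝔄 : Type*} [CStarAlgebra 𝔄] [PartialOrder 𝔄] [StarOrderedRing 𝔄] {A D : 𝔄}

lemma map_mul_smul_one_sub_eq_zero_iff {𝔄 : Type*} [CStarAlgebra 𝔄] [PartialOrder 𝔄] {A : 𝔄}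
    {f : 𝔄 →ₚ[ℂ] ℂ} (hf : f A = 1) {X : 𝔄} {z : ℂ} :
    f (A * (z • (1 : 𝔄) - X)) = 0 ↔ z = f (A * X) := by
  simp [mul_sub, hf, sub_eq_zero]

/-- `X ∈ 𝔄^A` is not `A`-left invertible exactly if some `A`-state annihilates `X⋆AX`. -/
lemma not_isALeftInvertible_iff (hA : 0 ≤ A) (hD : IsGroupInverse A D) {X : 𝔄}
    (hX : X ∈ aBounded A) :
    ¬ IsALeftInvertible A X ↔ ∃ f ∈ aStates A, f (star X * A * X) = 0 := by
  have hP := hD.star_proj (.of_nonneg hA)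
  constructor
  · intro h
    set T := cornerExt A D X with hT
    obtain ⟨h, h1, hTT⟩ := exists_state_map_eq_zero (star_mul_self_nonneg T)
      (fun hu ↦ h (isALeftInvertible_of_isUnit hA hD hX hu))
    have hz := map_mul_eq_zero_of_map_star_mul_self h hTT
    -- Since `(1 - P)T = 1 - P`, the state `h` is concentrated on `P`.
    have hP1 : h (A * D) = 1 := by
      have := hz (1 - A * D)
      rw [one_sub_proj_mul_cornerExt hD, map_sub, h1, sub_eq_zero] at this
      exact this.symm
    have hk : conjFunctional h (A * D) A = h A := by
      rw [conjFunctional_apply, hP, hD.mul_mul_self, hD.mul_proj]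
    obtain ⟨f, hf, hfx⟩ := exists_aState_of_positive hA (conjFunctional h (A * D))
      (hk ▸ (map_ne_zero_of_map_proj_eq_one hA hD hP1).1)
    refine ⟨f, hf, ?_⟩
    have h2 : star (A * D) * (star X * A * X) * (A * D) = star (A * D) * star X * A * T := by
      have := (mem_aBounded_iff hA hD).mp hX
      calc _ = star (A * D) * star X * (A * X * (A * D)) := by simp only [mul_assoc]
        _ = _ := by rw [this, mul_assoc _ A, mul_cornerExt hD]
    rw [hfx, conjFunctional_apply h _ (star X * A * X), h2, hz, mul_zero]
  · rintro ⟨g, hg, h0⟩ ⟨Y, hY, hYX⟩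
    obtain ⟨f, hgf, hf⟩ := exists_positive_of_mem_aStates hA hg
    rw [hgf] at h0
    have h1 := map_mul_mul_eq_zero hA f h0 (A * Y * D)
    have h2 : A * Y * D * A * X = A := by
      rw [mul_assoc (A * Y), hD.comm, (mem_aBounded_iff hA hD).mp hY, hYX]
    rw [h2, hf] at h1
    exact one_ne_zero h1

/-- `X ∈ 𝔄^A` is not `A`-right invertible exactly if some `A`-state annihilates `AXX⋆A`. -/
lemma not_isARightInvertible_iff (hA : 0 ≤ A) (hD : IsGroupInverse A D) {X : 𝔄}
    (hX : X ∈ aBounded A) :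
    ¬ IsARightInvertible A X ↔ ∃ f ∈ aStates A, f (A * X * star X * A) = 0 := by
  have hAs : IsSelfAdjoint A := .of_nonneg hA
  have hDs := hD.isSelfAdjoint
  constructor
  · intro h
    set T := cornerExt A D X with hT
    obtain ⟨h, h1, hTT⟩ := exists_state_map_eq_zero (mul_star_self_nonneg T)
      (fun hu ↦ h (isARightInvertible_of_isUnit hA hD hX hu))
    have hz := map_star_mul_eq_zero_of_map_star_mul_self h (b := star T) (by rwa [star_star])
    simp only [star_star] at hz
    -- Since `T(1 - P) = 1 - P`, the state `h` is concentrated on `P`.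
    have hP1 : h (A * D) = 1 := by
      have := hz (1 - A * D)
      rw [cornerExt_mul_one_sub_proj hA hD hX, map_sub, h1, sub_eq_zero] at this
      exact this.symm
    have hk : conjFunctional h D A = h D := by
      rw [conjFunctional_apply, hDs.star_eq, hD.self_mul_mul]
    obtain ⟨f, hf, hfx⟩ := exists_aState_of_positive hA (conjFunctional h D)
      (hk ▸ (map_ne_zero_of_map_proj_eq_one hA hD hP1).2)
    refine ⟨f, hf, ?_⟩
    have h2 : star D * (A * X * star X * A) * D = T * (A * D * star X * A * D) := by
      calc _ = D * A * X * star X * A * D := by rw [hDs.star_eq]; simp only [mul_assoc]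
        _ = T * (A * D) * star X * A * D := by rw [hD.comm, cornerExt_mul_proj hA hD hX]
        _ = _ := by simp only [mul_assoc]
    rw [hfx, conjFunctional_apply h _ (A * X * star X * A), h2, hz, mul_zero]
  · rintro ⟨g, hg, h0⟩ ⟨Y, -, hXY⟩
    obtain ⟨f, hgf, hf⟩ := exists_positive_of_mem_aStates hA hg
    rw [hgf] at h0
    have h1 := map_star_mul_eq_zero_of_map_star_mul_self f (b := star X * A)
      (by simpa [hAs.star_eq, mul_assoc] using h0) Y
    rw [star_mul, hAs.star_eq, star_star, hXY, hf] at h1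
    exact one_ne_zero h1

lemma leftASpectrum_eq (hA : 0 ≤ A) (hD : IsGroupInverse A D) {X : 𝔄} (hX : X ∈ aBounded A) :
    leftASpectrum A X = {z : ℂ | ∃ f ∈ aStates A,
      f (star X * A * X) = ((‖f (A * X)‖ ^ 2 : ℝ) : ℂ) ∧ z = f (A * X)} := by
  have hAs : IsSelfAdjoint A := .of_nonneg hA
  ext z
  rw [leftASpectrum, Set.mem_ofPred_eq, Set.mem_ofPred_eq,
    not_isALeftInvertible_iff hA hD (smul_one_sub_mem_aBounded hA hD hX z)]
  refine exists_congr fun g ↦ and_congr_right fun hg ↦ ?_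
  obtain ⟨f, hgf, hf⟩ := exists_positive_of_mem_aStates hA hg
  simp only [hgf]
  have hstar : f (star X * A) = star (f (A * X)) := by
    rw [← map_star f, star_mul, hAs.star_eq]
  have hexp : f (star (z • (1 : 𝔄) - X) * A * (z • (1 : 𝔄) - X)) =
      star z * z - star z * f (A * X) - z * star (f (A * X)) + f (star X * A * X) := by
    simp only [star_sub, star_smul, star_one, sub_mul, mul_sub, smul_mul_assoc, mul_smul_comm,
      one_mul, mul_one, map_sub, map_smul, smul_eq_mul, hf, hstar]
    ring
  have hsq : ((‖f (A * X)‖ ^ 2 : ℝ) : ℂ) = star (f (A * X)) * f (A * X) := by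
    push_cast
    exact (RCLike.conj_mul (f (A * X))).symm
  rw [hsq]
  constructor
  · intro h0
    have hz : z = f (A * X) := by
      rw [← map_mul_smul_one_sub_eq_zero_iff hf]
      simpa using map_mul_mul_eq_zero hA f h0 1
    rw [hexp, ← hz] at h0
    refine ⟨?_, hz⟩
    rw [← hz]
    linear_combination h0
  · rintro ⟨h0, rfl⟩
    rw [hexp, h0]
    ring

lemma rightASpectrum_eq (hA : 0 ≤ A) (hD : IsGroupInverse A D) {X : 𝔄} (hX : X ∈ aBounded A) :
    rightASpectrum A X = {z : ℂ | ∃ f ∈ aStates A,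
      (f (A * X * star X * A) = f (A * X) * f (A * star X * A) ∧
        f (A * X) * f (A * star X * A) = ((‖f (A * X)‖ ^ 2 : ℝ) : ℂ) * f (A ^ 2)) ∧
      z = f (A * X)} := by
  have hAs : IsSelfAdjoint A := .of_nonneg hA
  ext z
  rw [rightASpectrum, Set.mem_ofPred_eq, Set.mem_ofPred_eq,
    not_isARightInvertible_iff hA hD (smul_one_sub_mem_aBounded hA hD hX z)]
  refine exists_congr fun g ↦ and_congr_right fun hg ↦ ?_
  obtain ⟨f, hgf, hf⟩ := exists_positive_of_mem_aStates hA hg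
  simp only [hgf]
  have hstar : f (A * X * A) = star (f (A * star X * A)) := by
    rw [← map_star f, star_mul, star_mul, star_star, hAs.star_eq, mul_assoc]
  have hA2 : star (f (A ^ 2)) = f (A ^ 2) := by
    rw [← map_star f, star_pow, hAs.star_eq]
  have hexp : f (A * (z • (1 : 𝔄) - X) * star (z • (1 : 𝔄) - X) * A) =
      star z * z * f (A ^ 2) - star z * star (f (A * star X * A)) - z * f (A * star X * A)
        + f (A * X * star X * A) := by
    simp only [star_sub, star_smul, star_one, sub_mul, mul_sub, smul_mul_assoc, mul_smul_comm,
      mul_one, map_sub, map_smul, smul_eq_mul, ← hstar, sq]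
    ring
  have hsq : ((‖f (A * X)‖ ^ 2 : ℝ) : ℂ) = star (f (A * X)) * f (A * X) := by
    push_cast
    exact (RCLike.conj_mul (f (A * X))).symm
  rw [hsq]
  constructor
  · intro h0
    have hvan := map_star_mul_eq_zero_of_map_star_mul_self f (b := star (z • (1 : 𝔄) - X) * A)
      (by simpa only [star_mul, star_star, hAs.star_eq, ← mul_assoc] using h0)
    simp only [star_mul, star_star, hAs.star_eq] at hvan
    have hz : z = f (A * X) := by
      rw [← map_mul_smul_one_sub_eq_zero_iff hf]
      simpa using hvan 1
    have h1 : star (f (A * star X * A)) = z * f (A ^ 2) := by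
      have := hvan A
      rw [mul_sub, sub_mul, map_sub, hstar, sub_eq_zero] at this
      rw [← this, sq]
      simp
    have h2 : f (A * star X * A) = star z * f (A ^ 2) := by
      rw [← star_star (f (A * star X * A)), h1, star_mul, hA2, mul_comm]
    rw [hexp, h1, h2] at h0
    rw [← hz, h2]
    exact ⟨⟨by linear_combination h0, by ring⟩, rfl⟩
  · rintro ⟨⟨h0, h1⟩, rfl⟩
    have h2 : star (f (A * X)) * star (f (A * star X * A)) =
        star (f (A * X)) * f (A * X) * f (A ^ 2) := by
      have := congrArg star h1
      simp only [star_mul, star_star, hA2] at this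
      linear_combination this
    rw [hexp, h0, h1, h2]
    ring

end Spectra

/-! ### Spectral permanence -/

section Permanence

variable {𝔄 : Type*} [CStarAlgebra 𝔄] [PartialOrder 𝔄] [StarOrderedRing 𝔄]
  {𝔅 : Type*} [CStarAlgebra 𝔅] [PartialOrder 𝔅] [StarOrderedRing 𝔅]

lemma map_mem_aBounded (ι : 𝔅 →⋆ₙₐ[ℂ] 𝔄) {B E : 𝔅} (hB : 0 ≤ B)
    (hE : IsGroupInverse B E) (hE' : IsGroupInverse (ι B) (ι E)) {X : 𝔅} (hX : X ∈ aBounded B) :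
    ι X ∈ aBounded (ι B) := by
  rw [mem_aBounded_iff (map_nonneg ι hB) hE', ← map_mul, ← map_mul, ← map_mul,
    (mem_aBounded_iff hB hE).mp hX]

/-- If the support projection of `B` is dominated by a multiple of `H` after applying `ι`, then it
is so before, and `H + (1 - P)` is invertible. -/
lemma isUnit_add_one_sub_proj (ι : 𝔅 →⋆ₙₐ[ℂ] 𝔄) (hι : Function.Injective ι) {P H : 𝔅}
    (hP : IsStarProjection P) (hH : 0 ≤ H) {k : ℝ} (hk : ι P ≤ k • ι H) :
    IsUnit (H + (1 - P)) := by
  -- Replacing `k` by `c ≥ 1` gives `1 = P + (1 - P) ≤ c (H + (1 - P))`.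
  set c : ℝ := max k 1
  have hc1 : 1 ≤ c := le_max_right _ _
  have h1 : P ≤ c • H := by
    rw [← sub_nonneg]
    refine nonneg_of_map_nonneg ι hι (((IsSelfAdjoint.all c).smul
      (IsSelfAdjoint.of_nonneg hH)).sub hP.isSelfAdjoint) ?_
    rw [map_sub, ← Complex.coe_smul, map_smul, Complex.coe_smul, sub_nonneg]
    exact hk.trans (smul_le_smul_of_nonneg_right (le_max_left _ _) (map_nonneg ι hH))
  have h2 : (1 : 𝔅) ≤ c • (H + (1 - P)) := by
    have h3 : 1 - P ≤ c • (1 - P) := by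
      simpa using smul_le_smul_of_nonneg_right hc1 hP.one_sub.nonneg
    calc (1 : 𝔅) = P + (1 - P) := by abel
      _ ≤ c • H + c • (1 - P) := add_le_add h1 h3
      _ = _ := (smul_add _ _ _).symm
  have h4 := CStarAlgebra.isUnit_of_le 1 h2
  have hc0 : c ≠ 0 := by linarith
  exact (isUnit_smul_iff (Units.mk0 c hc0) (H + (1 - P))).mp h4

/-- Permanence of left invertibility. A left inverse `Q` of `W = PX` in the corner of `𝔄` gives
`P = W⋆(Q⋆Q)W ≤ ‖Q⋆Q‖ W⋆W`, an inequality between elements of the image of `ι`. -/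
lemma isALeftInvertible_map_iff (ι : 𝔅 →⋆ₙₐ[ℂ] 𝔄) (hι : Function.Injective ι) {B E : 𝔅}
    (hB : 0 ≤ B) (hE : IsGroupInverse B E) (hE' : IsGroupInverse (ι B) (ι E)) {X : 𝔅}
    (hX : X ∈ aBounded B) : IsALeftInvertible (ι B) (ι X) ↔ IsALeftInvertible B X := by
  have hA : 0 ≤ ι B := map_nonneg ι hB
  have hP := hE'.star_proj (.of_nonneg hA)
  constructor
  · rintro ⟨Y, hY, hYX⟩
    refine isALeftInvertible_of_isUnit hB hE hX ?_
    rw [star_cornerExt_mul_cornerExt (.of_nonneg hB) hE]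
    set Q := ι B * ι E * Y with hQ
    have h1 : Q * ι (B * E * X) = ι (B * E) := by
      rw [map_mul, map_mul, ← mul_assoc, hQ, proj_mul_mul_proj hA hE' hY, ← hE'.comm,
        mul_assoc (ι E), mul_assoc (ι E), hYX]
    have h2 : ι (B * E) = star (ι (B * E * X)) * (star Q * Q) * ι (B * E * X) := by
      calc ι (B * E) = star (ι (B * E)) * ι (B * E) := by
            rw [map_mul, hP, hE'.proj_mul_proj]
        _ = _ := by rw [← h1, star_mul]; simp only [mul_assoc]
    refine isUnit_add_one_sub_proj ι hι (hE.isStarProjection (.of_nonneg hB))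
      (star_mul_self_nonneg _) (k := ‖star Q * Q‖) ?_
    rw [map_mul ι (star _), map_star, h2]
    exact CStarAlgebra.star_left_conjugate_le_norm_smul (.star_mul_self Q)
  · rintro ⟨Y, hY, hYX⟩
    exact ⟨ι Y, map_mem_aBounded ι hB hE hE' hY, by rw [← map_mul, ← map_mul, hYX]⟩

/-- Permanence of right invertibility. A right inverse `Y` of `W = PX`, in the sense `WY = P`, gives
`P = W(YY⋆)W⋆ ≤ ‖YY⋆‖ WW⋆`, an inequality between elements of the image of `ι`. -/
lemma isARightInvertible_map_iff (ι : 𝔅 →⋆ₙₐ[ℂ] 𝔄) (hι : Function.Injective ι) {B E : 𝔅}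
    (hB : 0 ≤ B) (hE : IsGroupInverse B E) (hE' : IsGroupInverse (ι B) (ι E)) {X : 𝔅}
    (hX : X ∈ aBounded B) : IsARightInvertible (ι B) (ι X) ↔ IsARightInvertible B X := by
  have hP := hE'.star_proj (.of_nonneg (map_nonneg ι hB))
  constructor
  · rintro ⟨Y, -, hXY⟩
    refine isARightInvertible_of_isUnit hB hE hX ?_
    rw [cornerExt_mul_star_cornerExt hB hE hX]
    have h1 : ι (B * E * X) * Y = ι (B * E) := by
      rw [map_mul, map_mul, ← hE'.comm, mul_assoc (ι E), mul_assoc (ι E), hXY]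
    have h2 : ι (B * E) = ι (B * E * X) * (Y * star Y) * star (ι (B * E * X)) := by
      calc ι (B * E) = ι (B * E) * star (ι (B * E)) := by
            rw [map_mul, hP, hE'.proj_mul_proj]
        _ = _ := by rw [← h1, star_mul]; simp only [mul_assoc]
    refine isUnit_add_one_sub_proj ι hι (hE.isStarProjection (.of_nonneg hB))
      (mul_star_self_nonneg _) (k := ‖Y * star Y‖) ?_
    rw [map_mul ι _ (star _), map_star, h2]
    exact CStarAlgebra.star_right_conjugate_le_norm_smul (.mul_star_self Y)
  · rintro ⟨Y, hY, hXY⟩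
    exact ⟨ι Y, map_mem_aBounded ι hB hE hE' hY, by rw [← map_mul, ← map_mul, hXY]⟩

/-- The units of the two algebras may differ, but only the products of `z - X` with the support
projection matter, and these agree. -/
lemma aSpectrum_map (ι : 𝔅 →⋆ₙₐ[ℂ] 𝔄) (hι : Function.Injective ι) {B E : 𝔅}
    (hB : 0 ≤ B) (hE : IsGroupInverse B E) (hE' : IsGroupInverse (ι B) (ι E)) {X : 𝔅}
    (hX : X ∈ aBounded B) : aSpectrum (ι B) (ι X) = aSpectrum B X := by
  have hz (z : ℂ) : ι B * ι E * (z • (1 : 𝔄) - ι X) = ι (B * E * (z • (1 : 𝔅) - X)) := by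
    simp [mul_sub]
  have hmem (z : ℂ) : B * E * (z • (1 : 𝔅) - X) ∈ aBounded B :=
    proj_mul_mem_aBounded hB hE (smul_one_sub_mem_aBounded hB hE hX z)
  ext z
  refine or_congr (not_congr ?_) (not_congr ?_)
  · rw [← isALeftInvertible_proj_mul_iff (map_nonneg ι hB) hE', hz,
      isALeftInvertible_map_iff ι hι hB hE hE' (hmem z), isALeftInvertible_proj_mul_iff hB hE]
  · rw [← isARightInvertible_proj_mul_iff hE', hz,
      isARightInvertible_map_iff ι hι hB hE hE' (hmem z), isARightInvertible_proj_mul_iff hE]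

end Permanence

end ASpectral

/-- A C*-subalgebra `𝔅` of `𝔄` that contains `A` is given as a unital C*-algebra `𝔅` with an
injective (hence isometric) *-homomorphism `ι : 𝔅 → 𝔄`, not assumed to preserve the unit, and an
element `B` of `𝔅` with `ι B = A`. A closed unital *-subalgebra with its inclusion is an example. -/
theorem mainTheorem1 (𝔄 : Type*) [CStarAlgebra 𝔄] [PartialOrder 𝔄] [StarOrderedRing 𝔄]
    (A : 𝔄) (hA : 0 ≤ A) (hAws : ASpectral.IsWellSupported A) :
    (∀ X ∈ ASpectral.aBounded A,
      ASpectral.rightASpectrum A X =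
          {z : ℂ | ∃ f ∈ ASpectral.aStates A,
            (f (A * X * star X * A) = f (A * X) * f (A * star X * A) ∧
              f (A * X) * f (A * star X * A) = ((‖f (A * X)‖ ^ 2 : ℝ) : ℂ) * f (A ^ 2)) ∧
            z = f (A * X)} ∧
        ASpectral.leftASpectrum A X =
          {z : ℂ | ∃ f ∈ ASpectral.aStates A,
            f (star X * A * X) = ((‖f (A * X)‖ ^ 2 : ℝ) : ℂ) ∧ z = f (A * X)}) ∧
    (∀ (𝔅 : Type*) [CStarAlgebra 𝔅] [PartialOrder 𝔅] [StarOrderedRing 𝔅]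
      (ι : 𝔅 →⋆ₙₐ[ℂ] 𝔄), Function.Injective ι →
      ∀ B : 𝔅, ι B = A →
        ∀ X ∈ ASpectral.aBounded B, ASpectral.aSpectrum A (ι X) = ASpectral.aSpectrum B X) := by
  have hA' := IsSelfAdjoint.of_nonneg hA
  refine ⟨fun X hX ↦ ?_, fun 𝔅 _ _ _ ι hι B hB X hX ↦ ?_⟩
  · have hD := ASpectral.isGroupInverse_cfcₙ_inv hA' hAws
    exact ⟨ASpectral.rightASpectrum_eq hA hD hX, ASpectral.leftASpectrum_eq hA hD hX⟩
  · subst hB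
    obtain ⟨E, hE, hE'⟩ := ASpectral.exists_isGroupInverse_map ι hι hA' hAws
    have hB0 : 0 ≤ B := ASpectral.nonneg_of_map_nonneg ι hι
      (hι (by rw [map_star, hA'.star_eq])) hA
    exact ASpectral.aSpectrum_map ι hι hB0 hE hE' hX
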